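/- **Theorem (linear-exponential stability of the affine PI--PGD).** Let $f:\mathbb{R}^n\to\mathbb{R}$ be strongly convex with parameter $\rho>0$ and $L$-smooth (differentiable with $L$-Lipschitz gradient, $L>0$), let $g:\mathbb{R}^n\to\overline{\mathbb{R}}$ be convex, closed and proper, let $A\in\mathbb{R}^{m\times n}$ have full row rank, and let $b\in\mathbb{R}^m$. Let $k_p=k_i>0$, $\gamma\in\,]0,1/L]$, and $$p\in\Big[\max\Big(\tfrac{k_pL}{3},\ \tfrac{k_p(1-2\gamma\rho)}{\gamma}\Big),\ \tfrac{k_p}{\gamma}\Big].$$ Consider the dynamics $\dot z=F(z)$, $z=(x,\lambda)\in\mathbb{R}^{n}\times\mathbb{R}^m$, given by $$\dot x=-x+\operatorname{prox}_{\gamma g}\big(x-\gamma(\nabla f(x)+A^\top\lambda)\big),\qquad \dot\lambda=(k_i-k_p)Ax+k_pA\operatorname{prox}_{\gamma g}\big(x-\gamma(\nabla f(x)+A^\top\lambda)\big)-k_ib,$$ where $\operatorname{prox}_{\gamma g}(x)=\operatorname{argmin}_{z}\, g(z)+\frac{1}{2\gamma}\|x-z\|_2^2$, and let $z^\star=(x^\star,\lambda^\star)$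 be a locally exponentially stable equilibrium. Put $\|z\|_P=\sqrt{z^\top Pz}$ with $P=\begin{bmatrix}pI_n&0\\0&I_m\end{bmatrix}$. Then there is a norm $\|\cdot\|_{\mathrm L}$ on $\mathbb{R}^{n}\times\mathbb{R}^m$ such that every solution converges linear-exponentially to $z^\star$ with respect to $\|\cdot\|_P$ and $\|\cdot\|_{\mathrm L}$, that is, there are $c_{\exp}>0$ and $r>0$ such that 1. every solution with $\|z(0)-z^\star\|_{\mathrm L}\le r$ satisfies $\|z(t)-z^\star\|_{\mathrm L}\le e^{-c_{\exp}t}\|z(0)-z^\star\|_{\mathrm L}$ for all $t\ge0$; 2. for each of the two norms $\|\cdot\|\in\{\|\cdot\|_P,\|\cdot\|_{\mathrm L}\}$ there are $c_{\mathrm{lin}}>0$ and $q_0,q_1\ge0$ such that for every solution with $\|z(0)-z^\star\|_{\mathrm L}>r$, setting $q=q_0+q_1\|z(0)-z^\star\|$, there is $t_{\mathrm{cross}}>0$ with $q-c_{\mathrm{lin}}t_{\mathrm{cross}}>0$ and, for all $t\ge0$, $$\|z(t)-z^\star\|\le\begin{cases}q-c_{\mathrm{lin}}t,& t\le t_{\mathrm{cross}},\\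 (q-c_{\mathrm{lin}}t_{\mathrm{cross}})\,e^{-c_{\exp}(t-t_{\mathrm{cross}})},& t>t_{\mathrm{cross}}.\end{cases}$$ -/

import Mathlib

noncomputable section

namespace PIPGD

/-! ### Extended-real-valued convex functions and the proximal operator -/

section Prox

variable {E : Type*} [NormedAddCommGroup E] [InnerProductSpace ℝ E]

/-- The epigraph `{(x, y) ∈ E × ℝ | g x ≤ y}` of an extended-real-valued function. -/
def epigraph (g : E → EReal) : Set (E × ℝ) :=
  {w | g w.1 ≤ (w.2 : EReal)}

/-- `g` is convex, closed and proper. -/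
structure IsConvexClosedProper (g : E → EReal) : Prop where
  convex : Convex ℝ (epigraph g)
  closed : IsClosed (epigraph g)
  ne_bot : ∀ x, g x ≠ ⊥
  exists_lt_top : ∃ x, g x < ⊤

/-- `v` minimizes `z ↦ g z + ‖x - z‖² / (2 γ)`. -/
def IsProxPoint (γ : ℝ) (g : E → EReal) (x v : E) : Prop :=
  ∀ z : E, g v + ((‖x - v‖ ^ 2 / (2 * γ) : ℝ) : EReal) ≤
    g z + ((‖x - z‖ ^ 2 / (2 * γ) : ℝ) : EReal)

/-- The proximal operator `prox_{γ g}`: a minimizer of `z ↦ g z + ‖x - z‖² / (2 γ)`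
(the unique one when `g` is convex, closed and proper and `γ > 0`). -/
def prox (γ : ℝ) (g : E → EReal) (x : E) : E :=
  Classical.epsilon (IsProxPoint γ g x)

/-- `f` is `L`-smooth: differentiable with `L`-Lipschitz gradient. -/
def IsLSmooth [CompleteSpace E] (L : ℝ) (f : E → ℝ) : Prop :=
  Differentiable ℝ f ∧ ∀ x y, ‖gradient f x - gradient f y‖ ≤ L * ‖x - y‖

end Prox

/-! ### Autonomous dynamics -/

section Dynamics

variable {Z : Type*} [NormedAddCommGroup Z] [NormedSpace ℝ Z]

/-- `z` is a solution on `[0, ∞)` of `ż = F(z)` (values at negative times are irrelevant). -/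
def IsSolution (F : Z → Z) (z : ℝ → Z) : Prop :=
  ∀ t, 0 ≤ t → HasDerivWithinAt z (F (z t)) (Set.Ici 0) t

/-- `zs` is a locally exponentially stable equilibrium of `ż = F(z)`. On a finite-dimensional
space this does not depend on the norm. -/
def IsLocallyExpStable (F : Z → Z) (zs : Z) : Prop :=
  F zs = 0 ∧ ∃ δ > 0, ∃ M > 0, ∃ α > 0, ∀ z : ℝ → Z, IsSolution F z → ‖z 0 - zs‖ ≤ δ →
    ∀ t, 0 ≤ t → ‖z t - zs‖ ≤ M * Real.exp (-α * t) * ‖z 0 - zs‖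

/-- The linear-exponential function: linear with slope `-clin` up to time `tcross`, then
exponentially decreasing with rate `cexp`. -/
def linexp (q clin cexp tcross t : ℝ) : ℝ :=
  if t ≤ tcross then q - clin * t
  else (q - clin * tcross) * Real.exp (-cexp * (t - tcross))

/-- Every solution of `ż = F(z)` starting outside the ball `{z | NL (z - zs) ≤ r}` satisfies, in
the norm `N`, a linear-exponential bound with exponential rate `cexp`. The linear rate `clin` is
uniform over the solutions, and the intercept is affine in the initial distance. -/
def LinExpBoundOutside (F : Z → Z) (zs : Z) (NL : Z → ℝ) (r cexp : ℝ) (N : Z → ℝ) : Prop :=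
  ∃ clin > 0, ∃ q₀ ≥ 0, ∃ q₁ ≥ 0, ∀ z : ℝ → Z, IsSolution F z → r < NL (z 0 - zs) →
    ∃ tcross > 0, 0 < (q₀ + q₁ * N (z 0 - zs)) - clin * tcross ∧
      ∀ t, 0 ≤ t → N (z t - zs) ≤ linexp (q₀ + q₁ * N (z 0 - zs)) clin cexp tcross t

/-- Every solution of `ż = F(z)` converges linear-exponentially to `zs` with respect to the norms
`NG` (global) and `NL` (local). -/
def LinExpConverges (F : Z → Z) (zs : Z) (NG NL : Z → ℝ) : Prop :=
  ∃ cexp > 0, ∃ r > 0,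
    (∀ z : ℝ → Z, IsSolution F z → NL (z 0 - zs) ≤ r →
      ∀ t, 0 ≤ t → NL (z t - zs) ≤ Real.exp (-cexp * t) * NL (z 0 - zs)) ∧
    LinExpBoundOutside F zs NL r cexp NG ∧
    LinExpBoundOutside F zs NL r cexp NL

end Dynamics

/-! ### The affine PI proximal-gradient dynamics -/

/-- The state space `ℝⁿ × ℝᵐ` of pairs `(x, λ)`. -/
abbrev State (n m : ℕ) : Type := EuclideanSpace ℝ (Fin n) × EuclideanSpace ℝ (Fin m)

/-- A matrix acting between Euclidean spaces. -/
def act {k l : ℕ} (A : Matrix (Fin k) (Fin l) ℝ) (x : EuclideanSpace ℝ (Fin l)) :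
    EuclideanSpace ℝ (Fin k) :=
  WithLp.toLp 2 (A.mulVec (WithLp.ofLp x))

/-- The vector field of the affine PI--PGD. -/
def field {n m : ℕ} (f : EuclideanSpace ℝ (Fin n) → ℝ) (g : EuclideanSpace ℝ (Fin n) → EReal)
    (A : Matrix (Fin m) (Fin n) ℝ) (b : EuclideanSpace ℝ (Fin m)) (kp ki γ : ℝ)
    (z : State n m) : State n m :=
  (-z.1 + prox γ g (z.1 - γ • (gradient f z.1 + act A.transpose z.2)),
   (ki - kp) • act A z.1
     + kp • act A (prox γ g (z.1 - γ • (gradient f z.1 + act A.transpose z.2)))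
     - ki • b)

/-- The block matrix `P = [p Iₙ, 0; 0, Iₘ]`. -/
def matP (n m : ℕ) (p : ℝ) : Matrix (Fin n ⊕ Fin m) (Fin n ⊕ Fin m) ℝ :=
  Matrix.fromBlocks (p • 1) 0 0 1

/-- The stacked vector of a pair `(x, λ)`. -/
def stack {n m : ℕ} (z : State n m) : Fin n ⊕ Fin m → ℝ :=
  Sum.elim (WithLp.ofLp z.1) (WithLp.ofLp z.2)

/-- The weighted norm `‖z‖_P = √(zᵀ P z)`. -/
def weightedNorm {n m : ℕ} (P : Matrix (Fin n ⊕ Fin m) (Fin n ⊕ Fin m) ℝ) (z : State n m) : ℝ :=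
  Real.sqrt (dotProduct (stack z) (P.mulVec (stack z)))

end PIPGD

end

/-! The weighted norm itself serves as the local norm. Write `x` for the difference of the primal
parts of two states and `W` for the difference of the primal parts of their velocities. Firm
nonexpansiveness of the proximal map, scaled by `k / γ`, cancels the multiplier terms in the
weighted inner product of the velocity difference with the state difference. What remains is minus a
quadratic expression in `x`, `W` and the gradient difference, which the bounds on `p` make coercive.
Hence the field is weakly contracting with dissipation `c * (‖x‖ ^ 2 + ‖W‖ ^ 2)`
(`exists_weightedInner_field_le`), but the multiplier difference does not appear in it.

Local exponential stability recovers the multiplier. A solution that halves its distance in a fixed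
time must move, so near the equilibrium the speed dominates the distance
(`IsLocallyExpStable.exists_le_norm`). As `kp = ki`, the dual velocity is `k • act A (x + W)`
relative to the equilibrium, so `‖x‖ + ‖W‖` dominates the speed and therefore the full distance. The
dissipation then gives exponential decay in a small ball (`exists_local_decrease`).

Weak contraction carries the radial decay rate found on the sphere of radius `r` outward along rays
(`weightedInner_le_min`): the distance decreases at rate at least `c * r` outside the ball, and
exponentially inside. -/

noncomputable section

namespace PIPGD

/-! ### Existence and firm nonexpansiveness of the proximal map. -/

section Prox

variable {E : Type*} [NormedAddCommGroup E] [InnerProductSpace ℝ E]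

/-- A convex, closed and proper function has an affine minorant. -/
lemma IsConvexClosedProper.exists_affine_minorant {g : E → EReal} (hg : IsConvexClosedProper g)
    (x : E) : ∃ C D : ℝ, 0 ≤ D ∧ ∀ w ∈ epigraph g, -C - D * ‖x - w.1‖ ≤ w.2 := by
  obtain ⟨x₀, hx₀⟩ := hg.exists_lt_top
  obtain ⟨r₀, hr₀⟩ : ∃ r : ℝ, g x₀ = r :=
    ⟨(g x₀).toReal, (EReal.coe_toReal hx₀.ne (hg.ne_bot x₀)).symm⟩
  have hmem : (x₀, r₀) ∈ epigraph g := hr₀.le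
  have hnot : (x₀, r₀ - 1) ∉ epigraph g := by
    intro h
    have h' : g x₀ ≤ ((r₀ - 1 : ℝ) : EReal) := h
    rw [hr₀, EReal.coe_le_coe_iff] at h'
    linarith
  obtain ⟨l, u, hl, hu⟩ := geometric_hahn_banach_point_closed hg.convex hg.closed hnot
  have hdec : ∀ (e : E) (t : ℝ), l (e, t) = l (e, 0) + t * l (0, 1) := by
    intro e t
    have : (e, t) = (e, (0 : ℝ)) + t • ((0 : E), (1 : ℝ)) := by simp
    rw [this, map_add, map_smul, smul_eq_mul]
  -- Both points lie over `x₀`, so the separating hyperplane cannot be vertical and can be solved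
  -- for the last coordinate.
  have hβ : 0 < l (0, 1) := by
    have h1 := hu _ hmem
    rw [hdec] at hl h1
    linarith
  set β := l (0, 1)
  refine ⟨-(u - l (x, 0)) / β, ‖l‖ / β, by positivity, fun w hw => ?_⟩
  have h1 := hu w hw
  rw [show w = (w.1, w.2) from rfl, hdec] at h1
  have h2 : l (w.1, 0) - l (x, 0) ≤ ‖l‖ * ‖x - w.1‖ := by
    rw [← map_sub]
    refine (le_abs_self _).trans ((l.le_opNorm _).trans ?_)
    simp [Prod.norm_def, norm_sub_rev]
  have h3 : -(-(u - l (x, 0)) / β) - ‖l‖ / β * ‖x - w.1‖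
      = (u - l (x, 0) - ‖l‖ * ‖x - w.1‖) / β := by
    field_simp
  rw [h3, div_le_iff₀ hβ]
  linarith

/-- Minimizing over the epigraph makes the objective continuous; closedness of the epigraph takes
the place of lower semicontinuity. The affine minorant makes a sublevel set bounded, since the
quadratic term outgrows it. -/
lemma exists_isProxPoint [FiniteDimensional ℝ E] {g : E → EReal} (hg : IsConvexClosedProper g)
    {γ : ℝ} (hγ : 0 < γ) (x : E) : ∃ v, IsProxPoint γ g x v := by
  obtain ⟨C, D, hD, hmin⟩ := hg.exists_affine_minorant x
  obtain ⟨x₀, hx₀⟩ := hg.exists_lt_top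
  have hreal : ∀ y, g y < ⊤ → ∃ r : ℝ, g y = r := fun y hy =>
    ⟨(g y).toReal, (EReal.coe_toReal hy.ne (hg.ne_bot y)).symm⟩
  obtain ⟨r₀, hr₀⟩ := hreal x₀ hx₀
  set J : E × ℝ → ℝ := fun w => w.2 + ‖x - w.1‖ ^ 2 / (2 * γ) with hJ
  have hJc : Continuous J := by fun_prop
  set c := J (x₀, r₀)
  set S : Set (E × ℝ) := epigraph g ∩ {w | J w ≤ c}
  have hw₀ : (x₀, r₀) ∈ S := ⟨hr₀.le, show J (x₀, r₀) ≤ c from le_rfl⟩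
  have hSc : IsClosed S := hg.closed.inter (isClosed_le hJc continuous_const)
  -- The summand `1` forces `s ≥ 1` whenever `s > R`, so that constants can be absorbed into
  -- multiples of `s`.
  set R := 2 * γ * (D + |C| + |c|) + 1 with hR
  have hbd : S ⊆ Metric.closedBall x R ×ˢ Set.Icc (-C - D * R) c := by
    rintro w ⟨hw, hwc⟩
    have h1 := hmin w hw
    have h2 : w.2 + ‖x - w.1‖ ^ 2 / (2 * γ) ≤ c := hwc
    set s := ‖x - w.1‖ with hs
    have hs0 : 0 ≤ s := norm_nonneg _
    have hsR : s ≤ R := by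
      by_contra! hlt
      have hpos : 0 ≤ D + |C| + |c| := by positivity
      have hs1 : 1 ≤ s := by
        have : 0 ≤ 2 * γ * (D + |C| + |c|) := by positivity
        linarith
      have h3 : s ^ 2 ≤ (C + D * s + c) * (2 * γ) := by
        rw [← div_le_iff₀ (by positivity)]
        linarith
      have h4 : C + D * s + c ≤ (D + |C| + |c|) * s := by
        nlinarith [le_abs_self C, le_abs_self c, abs_nonneg C, abs_nonneg c]
      have h5 : s ^ 2 ≤ (R - 1) * s := by
        rw [hR]
        nlinarith
      nlinarith
    refine ⟨?_, ?_, ?_⟩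
    · rw [Metric.mem_closedBall, dist_comm, dist_eq_norm]
      exact hsR
    · nlinarith
    · have : 0 ≤ s ^ 2 / (2 * γ) := by positivity
      linarith
  have hcomp : IsCompact S :=
    ((isCompact_closedBall x R).prod isCompact_Icc).of_isClosed_subset hSc hbd
  obtain ⟨w, hwS, hw⟩ := hcomp.exists_isMinOn ⟨_, hw₀⟩ hJc.continuousOn
  have hw' : ∀ y ∈ epigraph g, J w ≤ J y := by
    intro y hy
    by_cases h : J y ≤ c
    · exact hw ⟨hy, h⟩
    · exact hwS.2.trans (not_le.1 h).le
  refine ⟨w.1, fun z => ?_⟩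
  by_cases hz : g z = ⊤
  · rw [hz, EReal.top_add_coe]
    exact le_top
  · obtain ⟨r, hr⟩ := hreal z (lt_top_iff_ne_top.2 hz)
    have h1 : J w ≤ J (z, r) := hw' _ hr.le
    calc g w.1 + ((‖x - w.1‖ ^ 2 / (2 * γ) : ℝ) : EReal)
        ≤ (w.2 : EReal) + ((‖x - w.1‖ ^ 2 / (2 * γ) : ℝ) : EReal) :=
          add_le_add_left hwS.1 _
      _ ≤ g z + ((‖x - z‖ ^ 2 / (2 * γ) : ℝ) : EReal) := by
          rw [hr, ← EReal.coe_add, ← EReal.coe_add, EReal.coe_le_coe_iff]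
          exact h1

lemma isProxPoint_prox [FiniteDimensional ℝ E] {g : E → EReal} (hg : IsConvexClosedProper g)
    {γ : ℝ} (hγ : 0 < γ) (x : E) : IsProxPoint γ g x (prox γ g x) :=
  Classical.epsilon_spec (exists_isProxPoint hg hγ x)

lemma IsProxPoint.exists_coe {g : E → EReal} (hg : IsConvexClosedProper g) {γ : ℝ} {x v : E}
    (hv : IsProxPoint γ g x v) : ∃ a : ℝ, g v = a := by
  obtain ⟨x₀, hx₀⟩ := hg.exists_lt_top
  have hne : g v ≠ ⊤ := by
    intro h
    have h1 := hv x₀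
    rw [h, EReal.top_add_coe, top_le_iff] at h1
    exact (EReal.add_lt_top hx₀.ne (EReal.coe_ne_top _)).ne h1
  exact ⟨(g v).toReal, (EReal.coe_toReal hne (hg.ne_bot v)).symm⟩

/-- The variational inequality characterizing a proximal point. -/
lemma IsProxPoint.inner_le {g : E → EReal} (hg : IsConvexClosedProper g) {γ : ℝ} (hγ : 0 < γ)
    {x v z : E} (hv : IsProxPoint γ g x v) {a r : ℝ} (ha : g v = a) (hr : g z = r) :
    inner ℝ (x - v) (z - v) ≤ γ * (r - a) := by
  -- Test minimality at the point `(1 - s) • v + s • z`, divide by `s`, and later let `s` tend to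
  -- `0`.
  have key : ∀ s ∈ Set.Ioo (0 : ℝ) 1,
      2 * (inner ℝ (x - v) (z - v) - γ * (r - a)) ≤ s * ‖z - v‖ ^ 2 := by
    rintro s ⟨hs0, hs1⟩
    have hconv : (v, a) ∈ epigraph g := ha.le
    have hconv' : (z, r) ∈ epigraph g := hr.le
    have h1 := hg.convex hconv hconv' (sub_nonneg.2 hs1.le) hs0.le (sub_add_cancel 1 s)
    have h2 : g ((1 - s) • v + s • z) ≤ (((1 - s) * a + s * r : ℝ) : EReal) := h1
    have h3 := (hv ((1 - s) • v + s • z)).trans (add_le_add_left h2 _)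
    rw [ha, ← EReal.coe_add, ← EReal.coe_add, EReal.coe_le_coe_iff] at h3
    have h4 : x - ((1 - s) • v + s • z) = (x - v) - s • (z - v) := by module
    rw [h4, norm_sub_sq_real (x - v), inner_smul_right, norm_smul, Real.norm_eq_abs, mul_pow, sq_abs] at h3
    have h5 : (2 * γ)⁻¹ * (‖x - v‖ ^ 2 - 2 * (s * inner ℝ (x - v) (z - v))
        + s ^ 2 * ‖z - v‖ ^ 2) - (2 * γ)⁻¹ * ‖x - v‖ ^ 2 ≥ s * (a - r) := by
      rw [div_eq_inv_mul, div_eq_inv_mul] at h3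
      linarith
    rw [← mul_sub, ge_iff_le, ← div_eq_inv_mul, le_div_iff₀ (by positivity)] at h5
    have h6 : s * (2 * (inner ℝ (x - v) (z - v) - γ * (r - a))) ≤ s * (s * ‖z - v‖ ^ 2) := by
      linarith
    exact le_of_mul_le_mul_left h6 hs0
  have hlim : Filter.Tendsto (fun s : ℝ => s * ‖z - v‖ ^ 2) (nhdsWithin 0 (Set.Ioi 0))
      (nhds (0 * ‖z - v‖ ^ 2)) :=
    ((continuous_id.mul continuous_const).tendsto 0).mono_left nhdsWithin_le_nhds
  have h := ge_of_tendsto hlim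
    (Filter.eventually_of_mem (Ioo_mem_nhdsGT one_pos) key)
  linarith

/-- The proximal operator is firmly nonexpansive. -/
lemma inner_prox_sub_nonneg [FiniteDimensional ℝ E] {g : E → EReal}
    (hg : IsConvexClosedProper g) {γ : ℝ} (hγ : 0 < γ) (x y : E) :
    ‖prox γ g x - prox γ g y‖ ^ 2 ≤ inner ℝ (x - y) (prox γ g x - prox γ g y) := by
  have hx := isProxPoint_prox hg hγ x
  have hy := isProxPoint_prox hg hγ y
  obtain ⟨a, ha⟩ := hx.exists_coe hg
  obtain ⟨r, hr⟩ := hy.exists_coe hg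
  have h1 := hx.inner_le hg hγ ha hr
  have h2 := hy.inner_le hg hγ hr ha
  set v := prox γ g x
  set w := prox γ g y
  have h3 : inner ℝ (x - y) (v - w) - ‖v - w‖ ^ 2
      = -(inner ℝ (x - v) (w - v) + inner ℝ (y - w) (v - w)) := by
    rw [← real_inner_self_eq_norm_sq]
    simp only [inner_sub_left, inner_sub_right, real_inner_comm]
    ring
  linarith

lemma norm_prox_sub_le [FiniteDimensional ℝ E] {g : E → EReal}
    (hg : IsConvexClosedProper g) {γ : ℝ} (hγ : 0 < γ) (x y : E) :
    ‖prox γ g x - prox γ g y‖ ≤ ‖x - y‖ := by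
  have h := (inner_prox_sub_nonneg hg hγ x y).trans (real_inner_le_norm _ _)
  by_contra! hlt
  nlinarith [norm_nonneg (x - y), norm_nonneg (prox γ g x - prox γ g y)]

end Prox

/-! ### Inequalities for smooth and strongly convex functions. -/

section Gradient

variable {E : Type*} [NormedAddCommGroup E] [InnerProductSpace ℝ E] [CompleteSpace E]

lemma hasDerivAt_comp_segment {f : E → ℝ} (hf : Differentiable ℝ f) (x d : E) (t : ℝ) :
    HasDerivAt (fun t : ℝ => f (x + t • d)) (inner ℝ (gradient f (x + t • d)) d) t := by
  have h1 : HasDerivAt (fun t : ℝ => x + t • d) d t := by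
    simpa using ((hasDerivAt_id t).smul_const d).const_add x
  have h2 := (hf (x + t • d)).hasGradientAt.hasFDerivAt.comp_hasDerivAt t h1
  exact h2.congr_deriv (InnerProductSpace.toDual_apply_apply ..)

/-- The descent lemma. -/
lemma IsLSmooth.le_quadratic {L : ℝ} {f : E → ℝ} (hf : IsLSmooth L f) (x y : E) :
    f y ≤ f x + inner ℝ (gradient f x) (y - x) + L / 2 * ‖y - x‖ ^ 2 := by
  set d := y - x with hd
  set ψ : ℝ → ℝ := fun t => f (x + t • d) - t * inner ℝ (gradient f x) d - L / 2 * t ^ 2 * ‖d‖ ^ 2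
  have hder : ∀ t, HasDerivAt ψ
      (inner ℝ (gradient f (x + t • d)) d - inner ℝ (gradient f x) d - L * t * ‖d‖ ^ 2) t := by
    intro t
    have h1 := hasDerivAt_comp_segment hf.1 x d t
    have h2 := (hasDerivAt_id t).mul_const (inner ℝ (gradient f x) d)
    have h3 := (((hasDerivAt_id t).pow 2).const_mul (L / 2)).mul_const (‖d‖ ^ 2)
    refine ((h1.sub h2).sub h3).congr_deriv ?_
    simp only [id]
    push_cast
    ring
  have hanti : AntitoneOn ψ (Set.Icc 0 1) := by
    refine antitoneOn_of_hasDerivWithinAt_nonpos (convex_Icc 0 1)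
      (fun t _ => (hder t).continuousAt.continuousWithinAt)
      (fun t _ => (hder t).hasDerivWithinAt) fun t ht => ?_
    have ht0 : 0 ≤ t := (interior_subset ht).1
    have h1 := real_inner_le_norm (gradient f (x + t • d) - gradient f x) d
    have h2 := hf.2 (x + t • d) x
    rw [add_sub_cancel_left, norm_smul, Real.norm_eq_abs, abs_of_nonneg ht0] at h2
    rw [inner_sub_left] at h1
    nlinarith [mul_le_mul_of_nonneg_right h2 (norm_nonneg d)]
  have h := hanti (Set.left_mem_Icc.2 zero_le_one) (Set.right_mem_Icc.2 zero_le_one) zero_le_one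
  simp only [ψ, one_smul, zero_smul, add_zero, hd, add_sub_cancel] at h
  linarith

/-- The first-order lower bound of a strongly convex function. -/
lemma quadratic_le_of_strongConvexOn {ρ : ℝ} {f : E → ℝ} (hf : StrongConvexOn Set.univ ρ f)
    (hd : Differentiable ℝ f) (x y : E) :
    f x + inner ℝ (gradient f x) (y - x) + ρ / 2 * ‖y - x‖ ^ 2 ≤ f y := by
  set d := y - x with hdd
  have hder := hasDerivAt_comp_segment hd x d 0
  rw [zero_smul, add_zero, hasDerivAt_iff_tendsto_slope_zero] at hder
  have hr : Filter.Tendsto (fun t : ℝ => t⁻¹ • (f (x + (0 + t) • d) - f (x + (0 : ℝ) • d)))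
      (nhdsWithin 0 (Set.Ioi 0)) (nhds (inner ℝ (gradient f x) d)) :=
    hder.mono_left (nhdsWithin_mono _ fun t ht => ne_of_gt ht)
  have hlim : Filter.Tendsto (fun t : ℝ => f y - f x - (1 - t) * (ρ / 2 * ‖d‖ ^ 2))
      (nhdsWithin 0 (Set.Ioi 0)) (nhds (f y - f x - (1 - 0) * (ρ / 2 * ‖d‖ ^ 2))) := by
    have : Continuous fun t : ℝ => f y - f x - (1 - t) * (ρ / 2 * ‖d‖ ^ 2) := by fun_prop
    exact (this.tendsto 0).mono_left nhdsWithin_le_nhds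
  have hle := le_of_tendsto_of_tendsto hr hlim
    (Filter.eventually_of_mem (Ioo_mem_nhdsGT one_pos) ?_)
  · linarith
  · rintro t ⟨ht0, ht1⟩
    have h := hf.2 (Set.mem_univ x) (Set.mem_univ y) (sub_nonneg.2 ht1.le) ht0.le
      (sub_add_cancel 1 t)
    have h1 : (1 - t) • x + t • y = x + t • d := by rw [hdd]; module
    rw [h1, norm_sub_rev x y] at h
    simp only [smul_eq_mul, ← hdd] at h
    simp only [zero_add, zero_smul, add_zero, smul_eq_mul]
    rw [inv_mul_le_iff₀ ht0]
    linarith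

lemma inner_gradient_sub_ge {ρ : ℝ} {f : E → ℝ} (hf : StrongConvexOn Set.univ ρ f)
    (hd : Differentiable ℝ f) (x y : E) :
    ρ * ‖x - y‖ ^ 2 ≤ inner ℝ (gradient f x - gradient f y) (x - y) := by
  have h1 := quadratic_le_of_strongConvexOn hf hd x y
  have h2 := quadratic_le_of_strongConvexOn hf hd y x
  rw [norm_sub_rev y x, ← neg_sub x y, inner_neg_right] at h1
  rw [inner_sub_left]
  linarith

/-- The interpolation inequality for strongly convex functions with Lipschitz gradient. -/
lemma gradient_interpolation {ρ L : ℝ} {f : E → ℝ} (hρ : 0 < ρ)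
    (hf : StrongConvexOn Set.univ ρ f) (hL : IsLSmooth L f) (hρL : ρ ≤ L) (x y : E) :
    ‖gradient f x - gradient f y‖ ^ 2 + ρ * L * ‖x - y‖ ^ 2
      ≤ (ρ + L) * inner ℝ (gradient f x - gradient f y) (x - y) := by
  have hmono := inner_gradient_sub_ge hf hL.1 x y
  rcases hρL.eq_or_lt with rfl | hlt
  · have h := hL.2 x y
    have h' : ‖gradient f x - gradient f y‖ ^ 2 ≤ (ρ * ‖x - y‖) ^ 2 := by gcongr
    nlinarith
  · have hℓ : 0 < L - ρ := sub_pos.2 hlt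
    -- This is the co-coercivity argument for `f - ρ / 2 * ‖·‖ ^ 2`, whose gradient difference is
    -- `D`. The lower bound from `x` and the upper bound from `y` are compared at the gradient step
    -- of length `1 / (L - ρ)`; adding the two orderings of `x` and `y` gives the claim.
    have half : ∀ x y : E, f x + inner ℝ (gradient f x) (y - x) + ρ / 2 * ‖y - x‖ ^ 2
        + (L - ρ)⁻¹ / 2 * ‖(gradient f y - gradient f x) - ρ • (y - x)‖ ^ 2 ≤ f y := by
      intro x y
      set D := (gradient f y - gradient f x) - ρ • (y - x) with hD
      set s := (L - ρ)⁻¹ with hs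
      have hsℓ : s * (L - ρ) = 1 := inv_mul_cancel₀ hℓ.ne'
      have h1 := quadratic_le_of_strongConvexOn hf hL.1 x (y - s • D)
      have h2 := hL.le_quadratic y (y - s • D)
      have e1 : y - s • D - x = (y - x) - s • D := by abel
      have e2 : y - s • D - y = -(s • D) := by abel
      rw [e1, norm_sub_sq_real] at h1
      rw [e2, norm_neg] at h2
      have e3 : inner ℝ (gradient f y) D - inner ℝ (gradient f x) D - ρ * inner ℝ (y - x) D
          = ‖D‖ ^ 2 := by
        rw [← real_inner_self_eq_norm_sq, ← real_inner_smul_left, ← inner_sub_left,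
          ← inner_sub_left]
      rw [norm_smul, mul_pow, Real.norm_eq_abs, sq_abs] at h1 h2
      simp only [inner_sub_right, inner_neg_right, inner_smul_right] at h1 h2 ⊢
      have e4 : s * s * (L - ρ) * ‖D‖ ^ 2 = s * ‖D‖ ^ 2 := by rw [mul_assoc s s, hsℓ, mul_one]
      have e5 : s * (inner ℝ (gradient f y) D - inner ℝ (gradient f x) D
          - ρ * inner ℝ (y - x) D) = s * ‖D‖ ^ 2 := by rw [e3]
      nlinarith
    have h1 := half x y
    have h2 := half y x
    have e1 : (gradient f y - gradient f x) - ρ • (y - x)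
        = -((gradient f x - gradient f y) - ρ • (x - y)) := by module
    rw [e1, norm_neg, norm_sub_rev y x, ← neg_sub x y, inner_neg_right] at h1
    have h3 : (L - ρ)⁻¹ * ‖(gradient f x - gradient f y) - ρ • (x - y)‖ ^ 2
        ≤ inner ℝ (gradient f x - gradient f y) (x - y) - ρ * ‖x - y‖ ^ 2 := by
      rw [inner_sub_left]
      linarith
    rw [inv_mul_le_iff₀ hℓ, norm_sub_sq_real, inner_smul_right, norm_smul, mul_pow,
      Real.norm_eq_abs, sq_abs] at h3
    linarith

end Gradient

/-! ### Global solutions, and a lower bound on the speed near a stable equilibrium. -/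

section Existence

variable {Z : Type*} [NormedAddCommGroup Z] [NormedSpace ℝ Z]

/-- On the ball of radius `‖F z₀‖ / K` the speed is at most `2 * ‖F z₀‖`, so a solution cannot leave
it before time `1 / (2 * K)`. This time does not depend on `z₀`, which permits gluing. -/
lemma exists_local_solution [CompleteSpace Z] {F : Z → Z} {K : NNReal} (hK : 0 < K)
    (hF : LipschitzWith K F) (z₀ : Z) :
    ∃ α : ℝ → Z, α 0 = z₀ ∧ ∀ t ∈ Set.Icc (0 : ℝ) (1 / (2 * K)),
      HasDerivWithinAt α (F (α t)) (Set.Icc 0 (1 / (2 * K))) t := by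
  have hT : (0 : ℝ) ≤ 1 / (2 * K) := by positivity
  have hPL : IsPicardLindelof (fun _ => F) (tmin := 0) (tmax := 1 / (2 * K))
      ⟨0, Set.left_mem_Icc.2 hT⟩ z₀ (‖F z₀‖₊ / K) 0 (2 * ‖F z₀‖₊) K := by
    refine ⟨fun _ _ => hF.lipschitzOnWith, fun _ _ => continuousOn_const, fun t _ x hx => ?_, ?_⟩
    · have h1 : ‖F x - F z₀‖ ≤ K * ‖x - z₀‖ := hF.norm_sub_le x z₀
      have h2 : ‖x - z₀‖ ≤ ‖F z₀‖ / K := by simpa [dist_eq_norm] using hx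
      have h3 : (K : ℝ) * (‖F z₀‖ / K) = ‖F z₀‖ := by field_simp
      have h4 : ‖F x‖ ≤ ‖F x - F z₀‖ + ‖F z₀‖ := by
        simpa using norm_add_le (F x - F z₀) (F z₀)
      have h5 : (K : ℝ) * ‖x - z₀‖ ≤ K * (‖F z₀‖ / K) := by gcongr
      push_cast
      linarith
    · simp only [sub_zero, sub_self, max_eq_left hT]
      push_cast
      apply le_of_eq
      field_simp
      simp
  exact hPL.exists_eq_forall_mem_Icc_hasDerivWithinAt₀

/-- A globally Lipschitz vector field has a global forward solution from every point. -/
lemma exists_isSolution [CompleteSpace Z] {F : Z → Z} {K : NNReal} (hF : LipschitzWith K F)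
    (z₀ : Z) : ∃ z : ℝ → Z, IsSolution F z ∧ z 0 = z₀ := by
  have hF' : LipschitzWith (K + 1) F := hF.weaken (by simp)
  have hK : 0 < K + 1 := by positivity
  choose sol h0 hsol using exists_local_solution hK hF'
  set T : ℝ := 1 / (2 * ((K + 1 : NNReal) : ℝ)) with hTdef
  have hT : 0 < T := by positivity
  set s : ℕ → Z := fun k => Nat.rec z₀ (fun _ y => sol y T) k
  have hs : ∀ k, s (k + 1) = sol (s k) T := fun k => rfl
  set z : ℝ → Z := fun t => sol (s ⌊t / T⌋₊) (t - ⌊t / T⌋₊ * T) with hz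
  have hz_eq : ∀ (k : ℕ) (t : ℝ), t ∈ Set.Icc (k * T) ((k + 1 : ℕ) * T) →
      z t = sol (s k) (t - k * T) := by
    rintro k t ⟨h1, h2⟩
    rcases h2.eq_or_lt with rfl | hlt
    -- At the right endpoint the floor already selects the next piece, whose initial value is the
    -- final value of the current one.
    · have : ⌊((k + 1 : ℕ) : ℝ) * T / T⌋₊ = k + 1 := by
        rw [mul_div_cancel_right₀ _ hT.ne', Nat.floor_natCast]
      simp only [hz, this, sub_self, h0, hs]
      congr 1
      push_cast
      ring
    · have hfl : ⌊t / T⌋₊ = k := by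
        have ht0 : 0 ≤ t := le_trans (by positivity) h1
        rw [Nat.floor_eq_iff (by positivity)]
        refine ⟨(le_div_iff₀ hT).2 h1, (div_lt_iff₀ hT).2 ?_⟩
        exact_mod_cast hlt
      simp only [hz, hfl]
  have hpiece : ∀ (k : ℕ) (t : ℝ),
      HasDerivWithinAt z (F (z t)) (Set.Icc (k * T) ((k + 1 : ℕ) * T)) t := by
    intro k t
    by_cases ht : t ∈ Set.Icc (k * T) ((k + 1 : ℕ) * T)
    · have hmaps : Set.MapsTo (fun τ : ℝ => τ - k * T) (Set.Icc (k * T) ((k + 1 : ℕ) * T))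
          (Set.Icc 0 T) := by
        rintro τ ⟨h1, h2⟩
        push_cast at h2
        constructor <;> simp only <;> linarith
      have h1 := (hsol (s k) (t - k * T) (hmaps ht)).scomp t
        ((hasDerivWithinAt_id t _).sub_const (k * T)) hmaps
      rw [one_smul] at h1
      rw [hz_eq k t ht]
      exact h1.congr (fun τ hτ => hz_eq k τ hτ) (hz_eq k t ht)
    · exact hasDerivWithinAt_iff_hasFDerivWithinAt.2 <|
        HasFDerivWithinAt.of_notMem_closure (by rwa [isClosed_Icc.closure_eq])
  have hunion : ∀ (k : ℕ) (t : ℝ), HasDerivWithinAt z (F (z t)) (Set.Icc 0 ((k + 1 : ℕ) * T)) t := by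
    intro k
    induction k with
    | zero => intro t; simpa using hpiece 0 t
    | succ k ih =>
      intro t
      have h := (ih t).union (hpiece (k + 1) t)
      rwa [Set.Icc_union_Icc_eq_Icc (by positivity)] at h
      gcongr
      simp
  refine ⟨z, fun t ht => ?_, ?_⟩
  · obtain ⟨k, hk⟩ := exists_nat_gt (t / T)
    have hkt : t < (k + 1 : ℕ) * T := by
      rw [div_lt_iff₀ hT] at hk
      push_cast
      linarith
    refine (hunion k t).mono_of_mem_nhdsWithin ?_
    rw [← Set.Ici_inter_Iic]
    exact Filter.inter_mem self_mem_nhdsWithin (mem_nhdsWithin_of_mem_nhds (Iic_mem_nhds hkt))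
  · have := hz_eq 0 0 ⟨by simp, by positivity⟩
    rw [this]
    simp [h0, s]

lemma IsSolution.continuousOn {F : Z → Z} {z : ℝ → Z} (hz : IsSolution F z) :
    ContinuousOn z (Set.Ici 0) := fun t ht => (hz t ht).continuousWithinAt

/-- Near a locally exponentially stable equilibrium of a Lipschitz vector field, the vector field
is bounded below by a multiple of the distance to the equilibrium. -/
lemma IsLocallyExpStable.exists_le_norm [CompleteSpace Z] {F : Z → Z} {K : NNReal}
    (hF : LipschitzWith K F) {zs : Z} (hzs : IsLocallyExpStable F zs) :
    ∃ δ > 0, ∃ c > 0, ∀ z, ‖z - zs‖ ≤ δ → c * ‖z - zs‖ ≤ ‖F z‖ := by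
  obtain ⟨-, δ, hδ, M, hM, α, hα, hexp⟩ := hzs
  have hF' : LipschitzWith (K + 1) F := hF.weaken (by simp)
  set κ : ℝ := ((K + 1 : NNReal) : ℝ) with hκ
  have hκ0 : 0 < κ := by positivity
  obtain ⟨T, hT0, hT⟩ : ∃ T : ℝ, 0 < T ∧ M * Real.exp (-α * T) ≤ 1 / 2 := by
    have hlim : Filter.Tendsto (fun T : ℝ => M * Real.exp (-α * T)) Filter.atTop
        (nhds (M * 0)) := by
      refine Filter.Tendsto.const_mul M (Real.tendsto_exp_atBot.comp ?_)
      exact Filter.tendsto_id.const_mul_atTop_of_neg (neg_neg_of_pos hα)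
    rw [mul_zero] at hlim
    have h1 := hlim.eventually (ge_mem_nhds (by norm_num : (0 : ℝ) < 1 / 2))
    obtain ⟨T, h2, h3⟩ := (h1.and (Filter.eventually_gt_atTop 0)).exists
    exact ⟨T, h3, h2⟩
  have hexpT : 1 < Real.exp (κ * T) := Real.one_lt_exp_iff.2 (by positivity)
  -- Grönwall bounds the displacement over time `T` by `B * ‖F z₀‖`. The distance to `zs` has at
  -- least halved by then, so the displacement is at least `‖z₀ - zs‖ / 2`.
  set B := (Real.exp (κ * T) - 1) / κ with hB
  have hB0 : 0 < B := div_pos (by linarith) hκ0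
  refine ⟨δ, hδ, 1 / (2 * B), by positivity, fun z₀ hz₀ => ?_⟩
  obtain ⟨z, hz, hz0⟩ := exists_isSolution hF z₀
  have h1 := hexp z hz (by rwa [hz0]) T hT0.le
  rw [hz0] at h1
  have h2 : ‖z T - zs‖ ≤ 1 / 2 * ‖z₀ - zs‖ := h1.trans (by gcongr)
  have h3 : ‖z T - z₀‖ ≤ gronwallBound 0 κ ‖F z₀‖ (T - 0) := by
    refine norm_le_gronwallBound_of_norm_deriv_right_le (f := fun t => z t - z₀)
      (f' := fun t => F (z t)) (a := 0) (b := T) ?_ ?_ ?_ ?_ T (Set.right_mem_Icc.2 hT0.le)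
    · exact (hz.continuousOn.mono Set.Icc_subset_Ici_self).sub continuousOn_const
    · intro t ht
      exact ((hz t ht.1).mono (Set.Ici_subset_Ici.2 ht.1)).sub_const _
    · simp [hz0]
    · intro t _
      have h4 := hF'.norm_sub_le (z t) z₀
      have h5 : ‖F (z t)‖ ≤ ‖F (z t) - F z₀‖ + ‖F z₀‖ := by
        simpa using norm_add_le (F (z t) - F z₀) (F z₀)
      linarith
  rw [gronwallBound_of_K_ne_0 hκ0.ne'] at h3
  have h4 : ‖z T - z₀‖ ≤ B * ‖F z₀‖ := by
    refine h3.trans (le_of_eq ?_)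
    rw [hB]
    simp only [sub_zero]
    ring
  have h5 : ‖z₀ - zs‖ ≤ ‖z T - z₀‖ + ‖z T - zs‖ := by
    have := norm_sub_le (z T - zs) (z T - z₀)
    rw [sub_sub_sub_cancel_left] at this
    linarith
  rw [one_div, inv_mul_le_iff₀ (by positivity)]
  linarith

end Existence

/-! ### Scalar differential inequalities. -/

section Comparison

/-- If `V` decreases at rate `2 c min(√V, r) √V`, then `√V` decays exponentially once it is at
most `r`. -/
lemma sqrt_le_exp_of_deriv_le {V V' : ℝ → ℝ} {c r : ℝ} (hr : 0 ≤ r) (hc : 0 ≤ c)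
    (hV0 : ∀ t, 0 ≤ V t) (hV : ∀ t, 0 ≤ t → HasDerivWithinAt V (V' t) (Set.Ici 0) t)
    (hV' : ∀ t, 0 ≤ t → V' t ≤ -(2 * c * min √(V t) r * √(V t)))
    {t₀ : ℝ} (ht₀ : 0 ≤ t₀) (hsmall : √(V t₀) ≤ r) {t : ℝ} (ht : t₀ ≤ t) :
    √(V t) ≤ √(V t₀) * Real.exp (-c * (t - t₀)) := by
  have hsub : ∀ τ ∈ interior (Set.Ici t₀), 0 ≤ τ := fun τ hτ =>
    ht₀.trans (interior_subset hτ)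
  have hcont : ContinuousOn V (Set.Ici t₀) := fun τ hτ =>
    ((hV τ (ht₀.trans hτ)).mono (Set.Ici_subset_Ici.2 ht₀)).continuousWithinAt
  have hanti : AntitoneOn V (Set.Ici t₀) := by
    refine antitoneOn_of_hasDerivWithinAt_nonpos (convex_Ici t₀) hcont
      (fun τ hτ => (hV τ (hsub τ hτ)).mono (interior_subset.trans (Set.Ici_subset_Ici.2 ht₀)))
      fun τ hτ => (hV' τ (hsub τ hτ)).trans ?_
    have : 0 ≤ min √(V τ) r := le_min (Real.sqrt_nonneg _) hr
    simp only [Left.neg_nonpos_iff]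
    positivity
  have hle : ∀ τ, t₀ ≤ τ → √(V τ) ≤ r := fun τ hτ =>
    (Real.sqrt_le_sqrt (hanti Set.self_mem_Ici hτ hτ)).trans hsmall
  have hexp : ∀ τ : ℝ, HasDerivAt (fun τ => Real.exp (2 * c * (τ - t₀)))
      (Real.exp (2 * c * (τ - t₀)) * (2 * c)) τ := by
    intro τ
    have := (((hasDerivAt_id τ).sub_const t₀).const_mul (2 * c)).exp
    simpa using this
  have hanti2 : AntitoneOn (fun τ => Real.exp (2 * c * (τ - t₀)) * V τ) (Set.Ici t₀) := by
    refine antitoneOn_of_hasDerivWithinAt_nonpos (convex_Ici t₀)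
      (ContinuousOn.mul (by fun_prop) hcont)
      (fun τ hτ => (hexp τ).hasDerivWithinAt.mul ((hV τ (hsub τ hτ)).mono
        (interior_subset.trans (Set.Ici_subset_Ici.2 ht₀)))) fun τ hτ => ?_
    have h1 := hV' τ (hsub τ hτ)
    rw [min_eq_left (hle τ (interior_subset hτ)), mul_assoc, Real.mul_self_sqrt (hV0 τ)] at h1
    nlinarith [Real.exp_pos (2 * c * (τ - t₀))]
  have h := hanti2 Set.self_mem_Ici ht ht
  simp only [sub_self, mul_zero, Real.exp_zero, one_mul] at h
  have h2 : V t ≤ V t₀ * Real.exp (-c * (t - t₀)) ^ 2 := by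
    have h3 : Real.exp (-c * (t - t₀)) ^ 2 = (Real.exp (2 * c * (t - t₀)))⁻¹ := by
      rw [← Real.exp_neg, ← Real.exp_nat_mul]
      congr 1
      push_cast
      ring
    rw [h3, ← div_eq_mul_inv, le_div_iff₀ (Real.exp_pos _), mul_comm]
    exact h
  refine (Real.sqrt_le_sqrt h2).trans (le_of_eq ?_)
  rw [Real.sqrt_mul (hV0 _), Real.sqrt_sq (Real.exp_pos _).le]

/-- If `V` decreases at rate `2 c min(√V, r) √V`, then `√V` decreases at linear rate `c r` as
long as it exceeds `r`. -/
lemma sqrt_le_max_of_deriv_le {V V' : ℝ → ℝ} {c r : ℝ} (hr : 0 ≤ r) (hc : 0 ≤ c)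
    (hV : ∀ t, 0 ≤ t → HasDerivWithinAt V (V' t) (Set.Ici 0) t)
    (hV' : ∀ t, 0 ≤ t → V' t ≤ -(2 * c * min √(V t) r * √(V t)))
    {t : ℝ} (ht : 0 ≤ t) :
    √(V t) ≤ max r (√(V 0) - c * r * t) := by
  rw [le_max_iff, or_iff_not_imp_left, not_le]
  intro hlt
  have hcont : ContinuousOn V (Set.Ici 0) := fun τ hτ => (hV τ hτ).continuousWithinAt
  have hanti : AntitoneOn V (Set.Ici 0) := by
    refine antitoneOn_of_hasDerivWithinAt_nonpos (convex_Ici 0) hcont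
      (fun τ hτ => (hV τ (interior_subset hτ)).mono interior_subset)
      fun τ hτ => (hV' τ (interior_subset hτ)).trans ?_
    have : 0 ≤ min √(V τ) r := le_min (Real.sqrt_nonneg _) hr
    simp only [Left.neg_nonpos_iff]
    positivity
  have hbig : ∀ τ ∈ Set.Icc 0 t, r < √(V τ) := fun τ hτ =>
    hlt.trans_le (Real.sqrt_le_sqrt (hanti hτ.1 ht hτ.2))
  have hpos : ∀ τ ∈ Set.Icc 0 t, V τ ≠ 0 := fun τ hτ h0 => by
    have := hbig τ hτ
    rw [h0, Real.sqrt_zero] at this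
    linarith
  have hanti2 : AntitoneOn (fun τ => √(V τ) + c * r * τ) (Set.Icc 0 t) := by
    refine antitoneOn_of_hasDerivWithinAt_nonpos (convex_Icc 0 t)
      (ContinuousOn.add (hcont.mono Set.Icc_subset_Ici_self).sqrt (by fun_prop))
      (fun τ hτ => (((hV τ (interior_subset hτ).1).mono
        (interior_subset.trans Set.Icc_subset_Ici_self)).sqrt
          (hpos τ (interior_subset hτ))).add
            ((hasDerivAt_id τ).const_mul (c * r)).hasDerivWithinAt) fun τ hτ => ?_
    have hb := hbig τ (interior_subset hτ)
    have h1 := hV' τ (interior_subset hτ).1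
    rw [min_eq_right hb.le] at h1
    have hs : 0 < √(V τ) := hr.trans_lt hb
    have h2 : V' τ / (2 * √(V τ)) ≤ -(c * r) := by
      rw [div_le_iff₀ (by positivity)]
      linarith
    linarith
  have h := hanti2 (Set.left_mem_Icc.2 ht) (Set.right_mem_Icc.2 ht) ht
  simp only [mul_zero, add_zero] at h
  linarith

end Comparison

/-! ### Coercivity of the quadratic form behind the dissipation. -/

section Dissipation

/-- The inequality at `c = 0` is strict: `s ≤ 2 * η` gives `(s + η) ^ 2 ≤ 4 * η * s + η ^ 2`, and `s
≤ G - L / 3 < G - η / 4` makes this less than `4 * G * η`. Continuity then leaves room for a small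
positive `c`. -/
lemma exists_quadratic_margin {k G ρ L s : ℝ} (hk : 0 < k) (hρ : 0 < ρ) (hρL : ρ ≤ L)
    (hLG : L ≤ G) (hs0 : 0 ≤ s) (hs : s ≤ 2 * ρ) (hsG : s ≤ G - L / 3) :
    ∃ c > 0, c < k * G ∧ ∀ η ∈ ({ρ, L} : Set ℝ),
      (k * s + k * η) ^ 2 ≤ 4 * (k * G - c) * (k * η - c) := by
  have hstrict : ∀ η, ρ ≤ η → η ≤ L → (k * s + k * η) ^ 2 < 4 * (k * G) * (k * η) := by
    intro η h1 h2
    have h3 : (s + η) ^ 2 < 4 * G * η := by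
      nlinarith [mul_nonneg hs0 (by linarith : (0 : ℝ) ≤ 2 * η - s),
        mul_nonneg (by linarith : (0 : ℝ) ≤ G - L / 3 - s) (by linarith : (0 : ℝ) ≤ η),
        mul_nonneg (by linarith : (0 : ℝ) ≤ L - η) (by linarith : (0 : ℝ) ≤ η),
        mul_pos (hρ.trans_le h1) (hρ.trans_le h1)]
    nlinarith [mul_lt_mul_of_pos_left h3 (mul_pos hk hk)]
  have hev : ∀ η, ρ ≤ η → η ≤ L → ∀ᶠ c in nhdsWithin (0 : ℝ) (Set.Ioi 0),
      (k * s + k * η) ^ 2 ≤ 4 * (k * G - c) * (k * η - c) := by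
    intro η h1 h2
    have hcont : Continuous fun c : ℝ => 4 * (k * G - c) * (k * η - c) := by fun_prop
    have hlim := hcont.tendsto 0
    simp only [sub_zero] at hlim
    exact nhdsWithin_le_nhds (hlim.eventually (le_mem_nhds (hstrict η h1 h2)))
  have hG : 0 < k * G := mul_pos hk (by linarith)
  obtain ⟨c, ⟨h1, h2⟩, hc0, hcG⟩ := (((hev ρ le_rfl hρL).and (hev L hρL le_rfl)).and
    (Filter.eventually_of_mem (Ioo_mem_nhdsGT hG) fun c hc => hc)).exists
  refine ⟨c, hc0, hcG, ?_⟩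
  rintro η (rfl | rfl)
  exacts [h1, h2]

variable {E : Type*} [NormedAddCommGroup E] [InnerProductSpace ℝ E]

/-- Completing the square in `w` leaves a condition on `x` and `h`. Bounding `‖h‖ ^ 2` by `hint`
makes it affine in `inner ℝ h x`, so it need only be checked at the ends `ρ * ‖x‖ ^ 2` and `L * ‖x‖
^ 2`; these are the two cases of `hmargin`. -/
lemma quadratic_form_coercive {k G ρ L s c : ℝ} (hk : 0 < k) (hρL : ρ ≤ L)
    (hcG : c < k * G)
    (hmargin : ∀ η ∈ ({ρ, L} : Set ℝ), (k * s + k * η) ^ 2 ≤ 4 * (k * G - c) * (k * η - c))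
    {x w h : E} (hlow : ρ * ‖x‖ ^ 2 ≤ inner ℝ h x) (hup : inner ℝ h x ≤ L * ‖x‖ ^ 2)
    (hint : ‖h‖ ^ 2 + ρ * L * ‖x‖ ^ 2 ≤ (ρ + L) * inner ℝ h x) :
    c * (‖x‖ ^ 2 + ‖w‖ ^ 2) ≤
      k * s * inner ℝ x w + k * G * ‖w‖ ^ 2 + k * inner ℝ h x + k * inner ℝ h w := by
  set q := k * G - c with hq
  have hq0 : 0 < q := sub_pos.2 hcG
  have hsq : 0 ≤ ‖(2 * q) • w + ((k * s) • x + k • h)‖ ^ 2 := sq_nonneg _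
  have hlin : ‖(k * s) • x + k • h‖ ^ 2
      = (k * s) ^ 2 * ‖x‖ ^ 2 + 2 * (k * s) * k * inner ℝ h x + k ^ 2 * ‖h‖ ^ 2 := by
    rw [norm_add_sq_real, norm_smul, norm_smul, inner_smul_left, inner_smul_right, mul_pow,
      mul_pow, Real.norm_eq_abs, Real.norm_eq_abs, sq_abs, sq_abs, real_inner_comm]
    simp only [conj_trivial]
    ring
  rw [norm_add_sq_real, hlin, norm_smul, mul_pow, Real.norm_eq_abs, sq_abs] at hsq
  simp only [inner_smul_left, inner_add_right, inner_smul_right, conj_trivial] at hsq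
  rw [real_inner_comm x w, real_inner_comm h w] at hsq
  set X := ‖x‖ ^ 2
  set T := inner ℝ h x
  have hX : 0 ≤ X := sq_nonneg _
  have h1 := hmargin ρ (by simp)
  have h2 := hmargin L (by simp)
  have hmain : (k * s) ^ 2 * X + 2 * (k * s) * k * T + k ^ 2 * ((ρ + L) * T - ρ * L * X)
      ≤ 4 * q * (k * T - c * X) := by
    rcases hρL.eq_or_lt with rfl | hlt
    · have hT : T = ρ * X := le_antisymm hup hlow
      rw [hT]
      nlinarith [mul_le_mul_of_nonneg_right h1 hX]
    · have h3 := mul_le_mul_of_nonneg_right h1 (sub_nonneg.2 hup)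
      have h4 := mul_le_mul_of_nonneg_right h2 (sub_nonneg.2 hlow)
      have h5 : (L - ρ) * ((k * s) ^ 2 * X + 2 * (k * s) * k * T
          + k ^ 2 * ((ρ + L) * T - ρ * L * X)) ≤ (L - ρ) * (4 * q * (k * T - c * X)) := by
        linarith
      exact le_of_mul_le_mul_left h5 (sub_pos.2 hlt)
  have hh : k ^ 2 * ‖h‖ ^ 2 ≤ k ^ 2 * ((ρ + L) * T - ρ * L * X) := by
    gcongr
    linarith
  have hfin : 0 ≤ 4 * q * (q * ‖w‖ ^ 2 + (k * s * inner ℝ x w + k * inner ℝ h w)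
      + (k * T - c * X)) := by
    linarith
  have := nonneg_of_mul_nonneg_right hfin (by positivity)
  rw [hq] at this
  linarith

lemma exists_gradient_coercive [CompleteSpace E] {k G ρ L s : ℝ} {f : E → ℝ} (hk : 0 < k)
    (hρ : 0 < ρ) (hLG : L ≤ G) (hs0 : 0 ≤ s) (hs : s ≤ 2 * ρ) (hsG : s ≤ G - L / 3)
    (hf : StrongConvexOn Set.univ ρ f) (hfL : IsLSmooth L f) :
    ∃ c > 0, ∀ x y w : E, c * (‖x - y‖ ^ 2 + ‖w‖ ^ 2) ≤
      k * s * inner ℝ (x - y) w + k * G * ‖w‖ ^ 2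
        + k * inner ℝ (gradient f x - gradient f y) (x - y)
        + k * inner ℝ (gradient f x - gradient f y) w := by
  rcases subsingleton_or_nontrivial E with hE | hE
  · refine ⟨1, one_pos, fun x y w => ?_⟩
    -- The trivial space is separate because `ρ ≤ L` can fail there.
    rw [Subsingleton.elim x y, Subsingleton.elim w 0]
    simp
  · have hup : ∀ x y, inner ℝ (gradient f x - gradient f y) (x - y) ≤ L * ‖x - y‖ ^ 2 := by
      intro x y
      refine (real_inner_le_norm _ _).trans ?_
      rw [pow_two, ← mul_assoc]
      exact mul_le_mul_of_nonneg_right (hfL.2 x y) (norm_nonneg _)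
    have hρL : ρ ≤ L := by
      obtain ⟨x, hx⟩ := exists_ne (0 : E)
      have h := (inner_gradient_sub_ge hf hfL.1 x 0).trans (hup x 0)
      rw [sub_zero] at h
      exact le_of_mul_le_mul_right h (by positivity)
    obtain ⟨c, hc, hcG, hmargin⟩ := exists_quadratic_margin hk hρ hρL hLG hs0 hs hsG
    exact ⟨c, hc, fun x y w => quadratic_form_coercive hk hρL hcG hmargin
      (inner_gradient_sub_ge hf hfL.1 x y) (hup x y)
      (gradient_interpolation hρ hf hfL hρL x y)⟩

end Dissipation

/-! ### The weighted norm and linear-exponential decay. -/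

section Weighted

variable {E₁ E₂ : Type*} [NormedAddCommGroup E₁] [InnerProductSpace ℝ E₁]
  [NormedAddCommGroup E₂] [InnerProductSpace ℝ E₂]

/-- The bilinear form `p ⟪x, x'⟫ + ⟪λ, λ'⟫`. -/
def weightedInner (p : ℝ) (z w : E₁ × E₂) : ℝ :=
  p * inner ℝ z.1 w.1 + inner ℝ z.2 w.2

lemma weightedInner_self (p : ℝ) (z : E₁ × E₂) :
    weightedInner p z z = p * ‖z.1‖ ^ 2 + ‖z.2‖ ^ 2 := by
  simp [weightedInner]

lemma weightedInner_sub_left (p : ℝ) (z w v : E₁ × E₂) :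
    weightedInner p (z - w) v = weightedInner p z v - weightedInner p w v := by
  simp only [weightedInner, Prod.fst_sub, Prod.snd_sub, inner_sub_left]
  ring

lemma weightedInner_smul_right (p a : ℝ) (z w : E₁ × E₂) :
    weightedInner p z (a • w) = a * weightedInner p z w := by
  simp only [weightedInner, Prod.smul_fst, Prod.smul_snd, inner_smul_right]
  ring

lemma weightedInner_smul_left (p a : ℝ) (z w : E₁ × E₂) :
    weightedInner p (a • z) w = a * weightedInner p z w := by
  simp only [weightedInner, Prod.smul_fst, Prod.smul_snd, real_inner_smul_left]
  ring

lemma weightedInner_self_nonneg {p : ℝ} (hp : 0 ≤ p) (z : E₁ × E₂) :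
    0 ≤ weightedInner p z z := by
  rw [weightedInner_self]
  positivity

/-- The norm of the bilinear form `weightedInner p`, for `0 ≤ p`. -/
def weightedSeminorm (E₁ E₂ : Type*) [NormedAddCommGroup E₁] [InnerProductSpace ℝ E₁]
    [NormedAddCommGroup E₂] [InnerProductSpace ℝ E₂] (p : ℝ) : Seminorm ℝ (E₁ × E₂) :=
  (normSeminorm ℝ (WithLp 2 (E₁ × E₂))).comp
    ((WithLp.linearEquiv 2 ℝ (E₁ × E₂)).symm.toLinearMap ∘ₗ
      (√p • LinearMap.fst ℝ E₁ E₂).prod (LinearMap.snd ℝ E₁ E₂))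

lemma weightedSeminorm_apply {p : ℝ} (hp : 0 ≤ p) (z : E₁ × E₂) :
    weightedSeminorm E₁ E₂ p z = √(weightedInner p z z) := by
  have : weightedSeminorm E₁ E₂ p z = ‖WithLp.toLp 2 (√p • z.1, z.2)‖ := rfl
  rw [this, WithLp.prod_norm_eq_of_L2, weightedInner_self]
  simp [norm_smul, mul_pow, Real.sq_sqrt hp]

lemma eq_zero_of_weightedInner_self {p : ℝ} (hp : 0 < p) {z : E₁ × E₂}
    (hz : weightedInner p z z = 0) : z = 0 := by
  rw [weightedInner_self] at hz
  have h1 : 0 ≤ p * ‖z.1‖ ^ 2 := by positivity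
  have h2 : 0 ≤ ‖z.2‖ ^ 2 := by positivity
  have h3 : p * ‖z.1‖ ^ 2 = 0 := by linarith
  have h4 : ‖z.2‖ ^ 2 = 0 := by linarith
  ext1
  · simpa [hp.ne'] using h3
  · simpa using h4

lemma exists_norm_le_of_weightedInner_le {p δ : ℝ} (hp : 0 < p) (hδ : 0 < δ) :
    ∃ r > 0, ∀ z : E₁ × E₂, √(weightedInner p z z) ≤ r → ‖z‖ ≤ δ := by
  refine ⟨δ * min 1 √p, by positivity, fun z hz => ?_⟩
  have hmin0 : 0 ≤ min 1 √p := by positivity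
  rw [Real.sqrt_le_left (by positivity), weightedInner_self, mul_pow] at hz
  have h1 : min 1 √p ^ 2 ≤ 1 := pow_le_one₀ hmin0 (min_le_left _ _)
  have h2 : min 1 √p ^ 2 ≤ p := by
    calc min 1 √p ^ 2 ≤ √p ^ 2 := by gcongr; exact min_le_right _ _
      _ = p := Real.sq_sqrt hp.le
  have hδ2 : 0 ≤ δ ^ 2 := by positivity
  rw [Prod.norm_def]
  refine max_le ?_ ?_
  · refine le_of_sq_le_sq ?_ hδ.le
    refine le_of_mul_le_mul_left ?_ hp
    nlinarith [sq_nonneg ‖z.2‖]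
  · refine le_of_sq_le_sq ?_ hδ.le
    nlinarith [mul_nonneg hp.le (sq_nonneg ‖z.1‖)]

lemma IsSolution.hasDerivWithinAt_weightedInner {F : E₁ × E₂ → E₁ × E₂} {z : ℝ → E₁ × E₂}
    (hz : IsSolution F z) (p : ℝ) (zs : E₁ × E₂) {t : ℝ} (ht : 0 ≤ t) :
    HasDerivWithinAt (fun t => weightedInner p (z t - zs) (z t - zs))
      (2 * weightedInner p (F (z t)) (z t - zs)) (Set.Ici 0) t := by
  have h := (hz t ht).sub_const zs
  have h1 := (ContinuousLinearMap.fst ℝ E₁ E₂).hasFDerivAt.comp_hasDerivWithinAt t h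
  have h2 := (ContinuousLinearMap.snd ℝ E₁ E₂).hasFDerivAt.comp_hasDerivWithinAt t h
  have h3 := (h1.norm_sq.const_mul p).add h2.norm_sq
  simp only [weightedInner_self]
  refine h3.congr_deriv ?_
  simp only [weightedInner, Function.comp_apply, ContinuousLinearMap.coe_fst',
    ContinuousLinearMap.coe_snd', real_inner_comm]
  ring

/-- A weakly contracting vector field that decreases the squared weighted distance to an
equilibrium at an exponential rate near the equilibrium decreases the weighted distance at least
linearly away from it. -/
lemma weightedInner_le_min {F : E₁ × E₂ → E₁ × E₂} {zs : E₁ × E₂} {p c r : ℝ} (hp : 0 ≤ p)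
    (hr : 0 < r)
    (hmono : ∀ z w, weightedInner p (F z - F w) (z - w) ≤ 0)
    (hloc : ∀ z, √(weightedInner p (z - zs) (z - zs)) ≤ r →
      weightedInner p (F z) (z - zs) ≤ -(c * weightedInner p (z - zs) (z - zs)))
    (z : E₁ × E₂) :
    weightedInner p (F z) (z - zs) ≤
      -(c * min √(weightedInner p (z - zs) (z - zs)) r * √(weightedInner p (z - zs) (z - zs))) := by
  set N := √(weightedInner p (z - zs) (z - zs)) with hN
  have hNsq : N * N = weightedInner p (z - zs) (z - zs) :=
    Real.mul_self_sqrt (weightedInner_self_nonneg hp _)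
  rcases le_or_gt N r with h | h
  · rw [min_eq_left h, mul_assoc, hNsq]
    exact hloc z h
  · have hN0 : 0 < N := hr.trans h
    rw [min_eq_right h.le]
    set s := r / N with hs
    have hs0 : 0 < s := div_pos hr hN0
    have hs1 : s < 1 := (div_lt_one hN0).2 h
    -- The point of the segment from `zs` to `z` at weighted distance `r`. Monotonicity between `y`
    -- and `z` transfers the local estimate at `y` to `z`.
    set y := zs + s • (z - zs) with hy
    have hyz : y - zs = s • (z - zs) := by rw [hy]; abel
    have hzy : z - y = (1 - s) • (z - zs) := by rw [hy]; module
    have hsN : s * N = r := div_mul_cancel₀ r hN0.ne'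
    have hyV : weightedInner p (y - zs) (y - zs) = r * r := by
      rw [hyz, weightedInner_smul_left, weightedInner_smul_right, ← hNsq, ← hsN]
      ring
    have h1 := hloc y (by rw [hyV, Real.sqrt_mul_self hr.le])
    have h2 := hmono z y
    rw [hyV, hyz, weightedInner_smul_right] at h1
    rw [hzy, weightedInner_smul_right, weightedInner_sub_left] at h2
    have h3 : weightedInner p (F z) (z - zs) ≤ weightedInner p (F y) (z - zs) := by
      nlinarith
    have h4 : s * weightedInner p (F y) (z - zs) ≤ s * -(c * r * N) := by
      have : s * -(c * r * N) = -(c * (r * r)) := by rw [← hsN]; ring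
      linarith
    exact h3.trans (le_of_mul_le_mul_left h4 hs0)

/-- Linear-exponential convergence from a uniform decrease of the weighted distance. -/
lemma linExpConverges_of_weightedInner_le {F : E₁ × E₂ → E₁ × E₂} {zs : E₁ × E₂} {p c r : ℝ}
    (hp : 0 ≤ p) (hr : 0 < r) (hc : 0 < c)
    (hF : ∀ z, weightedInner p (F z) (z - zs) ≤
      -(c * min √(weightedInner p (z - zs) (z - zs)) r
        * √(weightedInner p (z - zs) (z - zs)))) :
    LinExpConverges F zs (fun z => √(weightedInner p z z)) (fun z => √(weightedInner p z z)) := by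
  have hexp : ∀ z : ℝ → E₁ × E₂, IsSolution F z → ∀ t₀, 0 ≤ t₀ →
      √(weightedInner p (z t₀ - zs) (z t₀ - zs)) ≤ r → ∀ t, t₀ ≤ t →
      √(weightedInner p (z t - zs) (z t - zs)) ≤
        √(weightedInner p (z t₀ - zs) (z t₀ - zs)) * Real.exp (-c * (t - t₀)) := by
    intro z hz t₀ ht₀ hsmall t ht
    refine sqrt_le_exp_of_deriv_le (V := fun t => weightedInner p (z t - zs) (z t - zs)) hr.le hc.le
      (fun t => weightedInner_self_nonneg hp _)
      (fun t ht => hz.hasDerivWithinAt_weightedInner p zs ht) (fun t _ => ?_) ht₀ hsmall ht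
    linarith [hF (z t)]
  have hout : LinExpBoundOutside F zs (fun z => √(weightedInner p z z)) r c
      (fun z => √(weightedInner p z z)) := by
    -- The intercept is the initial distance itself, and the crossing time `τ` below is when the
    -- line reaches height `r`.
    refine ⟨c * r, by positivity, 0, le_rfl, 1, zero_le_one, fun z hz hlt => ?_⟩
    simp only [zero_add, one_mul]
    set N₀ := √(weightedInner p (z 0 - zs) (z 0 - zs)) with hN₀
    have hlin : ∀ t, 0 ≤ t →
        √(weightedInner p (z t - zs) (z t - zs)) ≤ max r (N₀ - c * r * t) := by
      intro t ht
      refine sqrt_le_max_of_deriv_le (V := fun t => weightedInner p (z t - zs) (z t - zs))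
        hr.le hc.le (fun t ht => hz.hasDerivWithinAt_weightedInner p zs ht) (fun t _ => ?_) ht
      linarith [hF (z t)]
    have hcr : 0 < c * r := by positivity
    set τ := (N₀ - r) / (c * r) with hτ
    have hτ0 : 0 < τ := div_pos (sub_pos.2 hlt) hcr
    have hτr : N₀ - c * r * τ = r := by
      rw [hτ, mul_div_cancel₀ _ hcr.ne']
      ring
    refine ⟨τ, hτ0, by rw [hτr]; exact hr, fun t ht => ?_⟩
    rw [linexp]
    split_ifs with h
    · refine (hlin t ht).trans (max_le ?_ le_rfl)
      have : c * r * t ≤ c * r * τ := by gcongr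
      linarith
    · have h1 : √(weightedInner p (z τ - zs) (z τ - zs)) ≤ r := by
        have := hlin τ hτ0.le
        rwa [hτr, max_self] at this
      refine (hexp z hz τ hτ0.le h1 t (not_le.1 h).le).trans ?_
      rw [hτr]
      gcongr
  refine ⟨c, hc, r, hr, fun z hz hsmall t ht => ?_, hout, hout⟩
  have := hexp z hz 0 le_rfl hsmall t ht
  rwa [sub_zero, mul_comm] at this

end Weighted

/-! ### Dissipation of the affine PI--PGD. -/

section Field

variable {n m : ℕ}

lemma weightedNorm_matP (p : ℝ) (z : State n m) :
    weightedNorm (matP n m p) z = √(weightedInner p z z) := by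
  have h1 : ‖z.1‖ ^ 2 = WithLp.ofLp z.1 ⬝ᵥ WithLp.ofLp z.1 := by
    rw [EuclideanSpace.real_norm_sq_eq]
    simp only [dotProduct, pow_two]
  have h2 : ‖z.2‖ ^ 2 = WithLp.ofLp z.2 ⬝ᵥ WithLp.ofLp z.2 := by
    rw [EuclideanSpace.real_norm_sq_eq]
    simp only [dotProduct, pow_two]
  rw [weightedNorm, matP, stack, Matrix.fromBlocks_mulVec, weightedInner_self, h1, h2]
  simp [Matrix.smul_mulVec, Function.comp_def, sumElim_dotProduct_sumElim]

lemma act_sub (A : Matrix (Fin m) (Fin n) ℝ) (x y : EuclideanSpace ℝ (Fin n)) :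
    act A (x - y) = act A x - act A y :=
  map_sub (Matrix.toEuclideanLin A) x y

lemma inner_act (A : Matrix (Fin m) (Fin n) ℝ) (x : EuclideanSpace ℝ (Fin n))
    (l : EuclideanSpace ℝ (Fin m)) :
    inner ℝ (act A x) l = inner ℝ (act A.transpose l) x := by
  simp only [EuclideanSpace.inner_eq_star_dotProduct, act, star_trivial]
  rw [Matrix.dotProduct_mulVec, ← Matrix.mulVec_transpose, dotProduct_comm]

lemma exists_lipschitzWith_act (A : Matrix (Fin m) (Fin n) ℝ) : ∃ C, LipschitzWith C (act A) :=
  ⟨_, (LinearMap.toContinuousLinearMap (Matrix.toEuclideanLin A)).lipschitz⟩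

variable {f : EuclideanSpace ℝ (Fin n) → ℝ} {g : EuclideanSpace ℝ (Fin n) → EReal}
  {A : Matrix (Fin m) (Fin n) ℝ} {b : EuclideanSpace ℝ (Fin m)} {ρ L k γ p : ℝ}

lemma exists_lipschitzWith_field (hL : 0 ≤ L) (hfL : IsLSmooth L f)
    (hg : IsConvexClosedProper g) (hγ : 0 < γ) (kp ki : ℝ) :
    ∃ K, LipschitzWith K (field (n := n) (m := m) f g A b kp ki γ) := by
  obtain ⟨C, hC⟩ := exists_lipschitzWith_act A
  obtain ⟨C', hC'⟩ := exists_lipschitzWith_act A.transpose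
  have hgrad : LipschitzWith ⟨L, hL⟩ (gradient f) :=
    LipschitzWith.of_dist_le_mul fun x y => by
      rw [dist_eq_norm, dist_eq_norm]
      exact hfL.2 x y
  have hprox : LipschitzWith 1 (prox γ g) :=
    LipschitzWith.of_dist_le_mul fun x y => by
      simpa [dist_eq_norm] using norm_prox_sub_le hg hγ x y
  have hfst : LipschitzWith 1 (Prod.fst : State n m → _) := LipschitzWith.prod_fst
  have hsnd : LipschitzWith 1 (Prod.snd : State n m → _) := LipschitzWith.prod_snd
  have hy := hprox.comp (hfst.sub ((lipschitzWith_smul γ).comp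
    ((hgrad.comp hfst).add (hC'.comp hsnd))))
  exact ⟨_, (hfst.neg.add hy).prodMk
    ((((lipschitzWith_smul (ki - kp)).comp (hC.comp hfst)).add
      ((lipschitzWith_smul kp).comp (hC.comp hy))).sub (LipschitzWith.const _))⟩

/-- With equal gains the term in `ki - kp` vanishes, and the proximal point is the primal state plus
the primal velocity. -/
lemma field_snd_sub (z w : State n m) :
    (field f g A b k k γ z - field f g A b k k γ w).2
      = k • act A ((z.1 - w.1) + (field f g A b k k γ z - field f g A b k k γ w).1) := by
  have hy : ∀ z : State n m, (field f g A b k k γ z).2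
      = k • act A (z.1 + (field f g A b k k γ z).1) - k • b := by
    intro z
    simp [field]
  rw [Prod.snd_sub, hy z, hy w, sub_sub_sub_cancel_right, ← smul_sub, ← act_sub, Prod.fst_sub,
    add_sub_add_comm]

/-- The affine PI--PGD is dissipative in the weighted norm. -/
lemma exists_weightedInner_field_le (hρ : 0 < ρ) (hf : StrongConvexOn Set.univ ρ f)
    (hfL : IsLSmooth L f) (hg : IsConvexClosedProper g) (hk : 0 < k) (hγ : 0 < γ)
    (hγL : L ≤ 1 / γ) (hp1 : k * L / 3 ≤ p) (hp2 : k * (1 - 2 * γ * ρ) / γ ≤ p)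
    (hp3 : p ≤ k / γ) :
    ∃ c > 0, ∀ z w : State n m,
      weightedInner p (field f g A b k k γ z - field f g A b k k γ w) (z - w) ≤
        -(c * (‖z.1 - w.1‖ ^ 2 + ‖(field f g A b k k γ z - field f g A b k k γ w).1‖ ^ 2)) := by
  have hkγ : k / γ = k * (1 / γ) := by ring
  -- The value of `s` makes `k * s = k / γ - p`, the coefficient of the cross term. The three side
  -- conditions on `s` are exactly the three bounds on `p`.
  obtain ⟨c, hc, hcoer⟩ := exists_gradient_coercive (s := 1 / γ - p / k) hk hρ hγL
    (by rw [sub_nonneg, div_le_iff₀ hk, mul_comm, ← hkγ]; exact hp3)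
    (by
      have : 1 / γ - 2 * ρ ≤ p / k := by
        rw [le_div_iff₀ hk]
        refine le_trans (le_of_eq ?_) hp2
        field_simp
      linarith)
    (by
      have : L / 3 ≤ p / k := by
        rw [le_div_iff₀ hk]
        linarith
      linarith) hf hfL
  refine ⟨c, hc, fun z w => ?_⟩
  have hks : k * (1 / γ - p / k) = k * (1 / γ) - p := by field_simp
  rw [weightedInner, field_snd_sub, real_inner_smul_left, inner_act]
  have hD := hcoer z.1 w.1 (field f g A b k k γ z - field f g A b k k γ w).1
  set W := (field f g A b k k γ z - field f g A b k k γ w).1 with hW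
  set u := z.1 - γ • (gradient f z.1 + act A.transpose z.2) with hu
  set v := w.1 - γ • (gradient f w.1 + act A.transpose w.2) with hv
  have hy : prox γ g u - prox γ g v = (z.1 - w.1) + W := by
    simp only [hW, field, Prod.fst_sub, ← hu, ← hv]
    abel
  have hfirm := inner_prox_sub_nonneg hg hγ u v
  have huv : u - v = (z.1 - w.1) - γ • ((gradient f z.1 - gradient f w.1)
      + act A.transpose (z - w).2) := by
    rw [hu, hv, Prod.snd_sub, act_sub]
    module
  rw [hy, huv] at hfirm
  rw [hks] at hD
  set x := z.1 - w.1
  set h := gradient f z.1 - gradient f w.1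
  set a := act A.transpose (z - w).2
  simp only [norm_add_sq_real, inner_sub_left, inner_add_left, inner_add_right,
    real_inner_smul_left, real_inner_self_eq_norm_sq] at hfirm
  simp only [Prod.fst_sub, inner_add_right]
  change p * inner ℝ W x + k * (inner ℝ a x + inner ℝ a W) ≤ _
  rw [real_inner_comm x W]
  -- The factor `k / γ` turns the multiplier terms of `hfirm` into `k * (inner ℝ a x + inner ℝ a
  -- W)`, matching those of the goal.
  have hfirm' := mul_le_mul_of_nonneg_left hfirm (by positivity : 0 ≤ k * (1 / γ))
  have hγ1 : 1 / γ * γ = 1 := one_div_mul_cancel hγ.ne'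
  set G := 1 / γ
  have e : k * G * (‖x‖ ^ 2 + inner ℝ x W
      - (γ * (inner ℝ h x + inner ℝ a x + (inner ℝ h W + inner ℝ a W))))
      = k * G * (‖x‖ ^ 2 + inner ℝ x W) - k * (G * γ) *
        (inner ℝ h x + inner ℝ a x + (inner ℝ h W + inner ℝ a W)) := by ring
  rw [hγ1] at e
  linarith

/-- Near a locally exponentially stable equilibrium, the affine PI--PGD decreases the squared
weighted distance to the equilibrium at an exponential rate. -/
lemma exists_local_decrease {zs : State n m} {K : NNReal} {c₁ : ℝ} (hp : 0 < p) (hk : 0 < k)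
    (hc₁ : 0 < c₁) (hK : LipschitzWith K (field f g A b k k γ))
    (hzs : IsLocallyExpStable (field f g A b k k γ) zs)
    (hdis : ∀ z w : State n m,
      weightedInner p (field f g A b k k γ z - field f g A b k k γ w) (z - w) ≤
        -(c₁ * (‖z.1 - w.1‖ ^ 2 + ‖(field f g A b k k γ z - field f g A b k k γ w).1‖ ^ 2))) :
    ∃ c > 0, ∃ r > 0, ∀ z, √(weightedInner p (z - zs) (z - zs)) ≤ r →
      weightedInner p (field f g A b k k γ z) (z - zs)
        ≤ -(c * weightedInner p (z - zs) (z - zs)) := by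
  obtain ⟨δ, hδ, c₂, hc₂, hlow⟩ := hzs.exists_le_norm hK
  obtain ⟨C, hC⟩ := exists_lipschitzWith_act A
  obtain ⟨r, hr, hball⟩ := exists_norm_le_of_weightedInner_le
    (E₁ := EuclideanSpace ℝ (Fin n)) (E₂ := EuclideanSpace ℝ (Fin m)) hp hδ
  set B : ℝ := 1 + k * C with hB
  have hB0 : 0 < B := by positivity
  set Q : ℝ := p + 2 * (B / c₂) ^ 2 with hQ
  have hQ0 : 0 < Q := by positivity
  refine ⟨c₁ / Q, by positivity, r, hr, fun z hz => ?_⟩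
  have h1 := hdis z zs
  have h2 := hlow z (hball _ hz)
  have h3 := field_snd_sub (f := f) (g := g) (A := A) (b := b) (k := k) (γ := γ) z zs
  rw [hzs.1, sub_zero] at h1 h3
  set W := (field f g A b k k γ z).1 with hW
  have h4 : ‖(field f g A b k k γ z).2‖ ≤ k * (C * (‖z.1 - zs.1‖ + ‖W‖)) := by
    rw [h3, norm_smul, Real.norm_eq_abs, abs_of_pos hk]
    have h5 := hC.norm_sub_le ((z.1 - zs.1) + W) 0
    rw [← act_sub, sub_zero] at h5
    gcongr
    refine h5.trans ?_
    gcongr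
    exact norm_add_le _ _
  have hs0 : 0 ≤ ‖z.1 - zs.1‖ := norm_nonneg _
  have hw0 : 0 ≤ ‖W‖ := norm_nonneg _
  have h6 : ‖field f g A b k k γ z‖ ≤ B * (‖z.1 - zs.1‖ + ‖W‖) := by
    rw [Prod.norm_def, hB]
    have h7 : 0 ≤ k * (C * (‖z.1 - zs.1‖ + ‖W‖)) := by positivity
    refine max_le ?_ ?_
    · rw [← hW]
      linarith
    · linarith
  -- The multiplier error, absent from the dissipation, is recovered here: the distance is at most
  -- the speed divided by `c₂`.
  have h8 : ‖(z - zs).2‖ ≤ B / c₂ * (‖z.1 - zs.1‖ + ‖W‖) := by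
    rw [div_mul_eq_mul_div, le_div_iff₀ hc₂, mul_comm]
    exact (mul_le_mul_of_nonneg_left (norm_snd_le _) hc₂.le).trans (h2.trans h6)
  have h9 : weightedInner p (z - zs) (z - zs) ≤ Q * (‖z.1 - zs.1‖ ^ 2 + ‖W‖ ^ 2) := by
    rw [weightedInner_self, Prod.fst_sub]
    have h10 : ‖(z - zs).2‖ ^ 2 ≤ (B / c₂) ^ 2 * (2 * (‖z.1 - zs.1‖ ^ 2 + ‖W‖ ^ 2)) := by
      calc ‖(z - zs).2‖ ^ 2 ≤ (B / c₂ * (‖z.1 - zs.1‖ + ‖W‖)) ^ 2 := by gcongr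
        _ = (B / c₂) ^ 2 * (‖z.1 - zs.1‖ + ‖W‖) ^ 2 := mul_pow _ _ _
        _ ≤ _ := by
          gcongr
          exact add_sq_le
    have h11 : 0 ≤ p * ‖W‖ ^ 2 := by positivity
    rw [hQ]
    linarith
  refine h1.trans (neg_le_neg ?_)
  rw [div_mul_eq_mul_div, div_le_iff₀ hQ0]
  nlinarith

end Field

end PIPGD

end

theorem mainTheorem4 {n m : ℕ}
    (f : EuclideanSpace ℝ (Fin n) → ℝ) (g : EuclideanSpace ℝ (Fin n) → EReal)
    (A : Matrix (Fin m) (Fin n) ℝ) (b : EuclideanSpace ℝ (Fin m))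
    (ρ L kp ki γ p : ℝ)
    (hρ : 0 < ρ) (hL : 0 < L)
    (hf : StrongConvexOn Set.univ ρ f) (hfL : PIPGD.IsLSmooth L f)
    (hg : PIPGD.IsConvexClosedProper g)
    (hA : A.rank = m)
    (hk : kp = ki) (hkp : 0 < kp)
    (hγ : γ ∈ Set.Ioc 0 (1 / L))
    (hp : p ∈ Set.Icc (max (kp * L / 3) (kp * (1 - 2 * γ * ρ) / γ)) (kp / γ))
    (zs : PIPGD.State n m)
    (hzs : PIPGD.IsLocallyExpStable (PIPGD.field f g A b kp ki γ) zs) :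
    ∃ NL : Seminorm ℝ (PIPGD.State n m), (∀ z, NL z = 0 → z = 0) ∧
      PIPGD.LinExpConverges (PIPGD.field f g A b kp ki γ) zs
        (PIPGD.weightedNorm (PIPGD.matP n m p)) NL := by
  subst hk
  obtain ⟨hγ0, hγL⟩ := hγ
  obtain ⟨hplow, hpup⟩ := hp
  have hp1 := (le_max_left _ _).trans hplow
  have hp2 := (le_max_right _ _).trans hplow
  have hp0 : 0 < p := lt_of_lt_of_le (by positivity) hp1
  obtain ⟨c₁, hc₁, hdis⟩ := PIPGD.exists_weightedInner_field_le (m := m) (A := A) (b := b) hρ hf hfL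
    hg hkp hγ0 ((le_one_div hL hγ0).2 hγL) hp1 hp2 hpup
  obtain ⟨K, hK⟩ := PIPGD.exists_lipschitzWith_field (A := A) (b := b) hL.le hfL hg hγ0 kp kp
  obtain ⟨c, hc, r, hr, hloc⟩ := PIPGD.exists_local_decrease hp0 hkp hc₁ hK hzs hdis
  have hNL : ⇑(PIPGD.weightedSeminorm (EuclideanSpace ℝ (Fin n)) (EuclideanSpace ℝ (Fin m)) p)
      = fun z => √(PIPGD.weightedInner p z z) :=
    funext fun z => PIPGD.weightedSeminorm_apply hp0.le z
  refine ⟨PIPGD.weightedSeminorm _ _ p, fun z hz => ?_, ?_⟩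
  · rw [PIPGD.weightedSeminorm_apply hp0.le,
      Real.sqrt_eq_zero (PIPGD.weightedInner_self_nonneg hp0.le z)] at hz
    exact PIPGD.eq_zero_of_weightedInner_self hp0 hz
  · rw [hNL, show PIPGD.weightedNorm (PIPGD.matP n m p) = fun z => √(PIPGD.weightedInner p z z) from
      funext fun z => PIPGD.weightedNorm_matP p z]
    refine PIPGD.linExpConverges_of_weightedInner_le hp0.le hr hc
      (PIPGD.weightedInner_le_min hp0.le hr (fun z w => (hdis z w).trans ?_) hloc)
    rw [neg_nonpos]
    positivity
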